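/- Consider the half-plane subgraph $H=\mathbb Z\times\{0,1,2,\dots\}$ of the square lattice $\mathbb Z^2$ (vertices at $\ell^1$-distance $1$ are joined by an edge). An environment $\omega$ assigns to each edge $e$ of $H$ a passage time $\omega(e)\in\{1,2\}$. Water starts at time $0$ from all vertices of the $x$-axis, and $\tau_\omega(v)$ denotes the first passage time of $v$, i.e. the minimum, over all paths in $H$ from the $x$-axis to $v$, of the sum of the passage times of the edges of the path. At time $t$ an edge $vw$ is active with source $v$ if the water has reached $v$, its flow from $v$ through $vw$ has not yet completed, and $w$ has not yet been reached: $\tau_\omega(v)\le t<\tau_\omega(v)+\omega(vw)$ and $t<\tau_\omega(w)$. A vertex is active at time $t$ if it is the source of some active edge. Let $N_t(\omega)$ be the (finite) number of vertices $(x,y)\in\{-t,\dots,t\}\times\{0,1,2,\dots\}$ that are active at time $t$. Theorem. Let $\alpha=\frac{4}{15\log 2}>0$. For every $t=2^k$ with $k\in\{0,1,2,\dots\}$ there is an environment $\omega$ such that $$N_t(\omega)\ge \alpha\, t\log t .$$ -/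

import Mathlib

namespace FPP

/-- The upper half-plane subgraph `ℤ × {0, 1, 2, …}` of the square lattice `ℤ²`: two vertices are
adjacent when they are at `ℓ¹`-distance one. -/
def halfPlane : SimpleGraph (ℤ × ℕ) where
  Adj p q := |p.1 - q.1| + |(p.2 : ℤ) - (q.2 : ℤ)| = 1
  symm := ⟨fun p q h => by
    rw [abs_sub_comm q.1 p.1, abs_sub_comm (q.2 : ℤ) (p.2 : ℤ)]; exact h⟩
  loopless := ⟨fun p h => by simp at h⟩

/-- The vertices of the `x`-axis, where the water is located at time `0`. -/
def xAxis : Set (ℤ × ℕ) := {p | p.2 = 0}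

/-- An environment assigns to each edge of the half-plane a passage time from `{1, 2}`. (The values
of `ω` at pairs that are not edges are irrelevant.) -/
def IsEnvironment (ω : Sym2 (ℤ × ℕ) → ℕ) : Prop :=
  ∀ e ∈ halfPlane.edgeSet, ω e = 1 ∨ ω e = 2

variable {V : Type*}

/-- The total passage time of a path (repeated vertices are allowed): the sum of the passage times
of its edges. -/
def walkTime {G : SimpleGraph V} (ω : Sym2 V → ℕ) {u v : V} (p : G.Walk u v) : ℕ :=
  (p.edges.map ω).sum

/-- The first passage time `τ(A, v)`: the first time at which water that starts on `A` at time `0`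
reaches `v`. It is `⊤` if the water never reaches `v`. -/
noncomputable def passageTime (G : SimpleGraph V) (ω : Sym2 V → ℕ) (A : Set V) (v : V) : ℕ∞ :=
  ⨅ (a : V) (_ : a ∈ A) (p : G.Walk a v), (walkTime ω p : ℕ∞)

/-- At time `t` the edge `vw` is active with source `v`: the water has reached `v`, the flow that
left `v` through `vw` when the water arrived there has not yet completed, and `w` has not yet been
reached by the water (otherwise the flow towards `w` is discarded). -/
def EdgeActiveFrom (G : SimpleGraph V) (ω : Sym2 V → ℕ) (A : Set V) (t : ℕ) (v w : V) : Prop :=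
  G.Adj v w ∧
    passageTime G ω A v ≤ t ∧
    (t : ℕ∞) < passageTime G ω A v + ω s(v, w) ∧
    (t : ℕ∞) < passageTime G ω A w

/-- A vertex is active at time `t` if it is the source of some active edge. -/
def IsActive (G : SimpleGraph V) (ω : Sym2 V → ℕ) (A : Set V) (t : ℕ) (v : V) : Prop :=
  ∃ w, EdgeActiveFrom G ω A t v w

/-- The set of vertices of the half-plane with `x`-coordinate in `[-t, t]` that are active at
time `t`. -/
def activeSet (ω : Sym2 (ℤ × ℕ) → ℕ) (t : ℕ) : Set (ℤ × ℕ) :=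
  {p | -(t : ℤ) ≤ p.1 ∧ p.1 ≤ (t : ℤ) ∧ IsActive halfPlane ω xAxis t p}

/-- The number `N_t(ω)` of active vertices at time `t` with `x`-coordinate in `[-t, t]`. -/
noncomputable def numActive (ω : Sym2 (ℤ × ℕ) → ℕ) (t : ℕ) : ℕ :=
  (activeSet ω t).ncard

end FPP

/-! An environment may be replaced by a potential: if `T` vanishes on the axis, changes by at most 2
along edges and has no local minimum off the axis, then `potentialEnv T` has first passage time `T`
(`passageTime_potentialEnv`). So it suffices to design arrival times. `arrival` lets water run at
speed 1 from the axis points with abscissa `-t, 0, t` along a dyadic network of branches, and at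
speed 1/2 elsewhere. The branches bifurcate towards the line `d + y = t`: at distance `z` from it
they are spaced about `z` apart, and `InNetwork.exists_pred` shows that all of them are fed. Below a
branch near its tip, water leaking downwards has not yet met water from elsewhere
(`InNetwork.lt_of_hole`), so each column of this hole has an active vertex. Each of about `log t`
scales yields order `t` such vertices (`card_holeIndex`), and the tips add `2 * t + 1` more. -/

namespace FPP

/-! ### Environments with a prescribed passage time -/

section Potential

variable {V : Type*}

/-- The environment that a potential `T` induces: the passage time of an edge is the increment of
`T` along it, but at least one. -/
def potentialEnv (T : V → ℕ) : Sym2 V → ℕ :=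
  Sym2.lift ⟨fun u v => max 1 (Nat.dist (T u) (T v)), fun u v => by simp only [Nat.dist_comm]⟩

@[simp] lemma potentialEnv_mk (T : V → ℕ) (u v : V) :
    potentialEnv T s(u, v) = max 1 (Nat.dist (T u) (T v)) := rfl

lemma le_walkTime_potentialEnv {G : SimpleGraph V} (T : V → ℕ) {u v : V} (p : G.Walk u v) :
    T v ≤ T u + walkTime (potentialEnv T) p := by
  induction p with
  | nil => simp
  | @cons a b c h p ih =>
    have hw : walkTime (potentialEnv T) (SimpleGraph.Walk.cons h p)
        = max 1 (Nat.dist (T a) (T b)) + walkTime (potentialEnv T) p := by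
      simp [walkTime]
    rw [hw]
    have := Nat.dist_tri_right (T a) (T b)
    simp only [Nat.dist] at this ⊢
    omega

/-- A potential that vanishes on `A` and has no local minimum outside `A` is the first passage time
of the environment it induces. -/
lemma passageTime_potentialEnv {G : SimpleGraph V} {T : V → ℕ} {A : Set V}
    (hA : ∀ a ∈ A, T a = 0) (hdesc : ∀ v ∉ A, ∃ u, G.Adj u v ∧ T u < T v) (v : V) :
    passageTime G (potentialEnv T) A v = T v := by
  apply le_antisymm
  -- Along a descent each edge costs exactly the drop of `T`, so the costs telescope.
  · have key : ∀ n v, T v = n → ∃ a ∈ A, ∃ p : G.Walk a v, walkTime (potentialEnv T) p ≤ n := by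
      intro n
      induction n using Nat.strong_induction_on with
      | _ n ih =>
        intro v hv
        by_cases hvA : v ∈ A
        · exact ⟨v, hvA, .nil, by simp [walkTime]⟩
        · obtain ⟨u, huv, hlt⟩ := hdesc v hvA
          obtain ⟨a, ha, p, hp⟩ := ih (T u) (hv ▸ hlt) u rfl
          refine ⟨a, ha, p.concat huv, ?_⟩
          have : walkTime (potentialEnv T) (p.concat huv)
              = walkTime (potentialEnv T) p + max 1 (Nat.dist (T u) (T v)) := by
            simp [walkTime, SimpleGraph.Walk.edges_concat]
          rw [this]
          simp only [Nat.dist]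
          omega
    obtain ⟨a, ha, p, hp⟩ := key _ v rfl
    exact (iInf₂_le_of_le a ha (iInf_le _ p)).trans (by exact_mod_cast hp)
  · refine le_iInf₂ fun a ha => le_iInf fun p => ?_
    have := le_walkTime_potentialEnv T p
    rw [hA a ha, zero_add] at this
    exact_mod_cast this

lemma isEnvironment_potentialEnv {T : ℤ × ℕ → ℕ}
    (hlip : ∀ u v, halfPlane.Adj u v → T v ≤ T u + 2) : IsEnvironment (potentialEnv T) := by
  intro e he
  induction e using Sym2.ind with
  | _ u v =>
    have h1 := hlip u v he
    have h2 := hlip v u (halfPlane.adj_symm he)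
    simp only [potentialEnv_mk, Nat.dist]
    omega

lemma isActive_potentialEnv {G : SimpleGraph V} {T : V → ℕ} {A : Set V}
    (hA : ∀ a ∈ A, T a = 0) (hdesc : ∀ v ∉ A, ∃ u, G.Adj u v ∧ T u < T v)
    {t : ℕ} {v w : V} (hvw : G.Adj v w) (hv : T v ≤ t) (hw : t < T w) :
    IsActive G (potentialEnv T) A t v := by
  refine ⟨w, hvw, ?_, ?_, ?_⟩
  · rw [passageTime_potentialEnv hA hdesc]; exact_mod_cast hv
  · rw [passageTime_potentialEnv hA hdesc]
    have : t < T v + potentialEnv T s(v, w) := by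
      simp only [potentialEnv_mk, Nat.dist]
      omega
    exact_mod_cast this
  · rw [passageTime_potentialEnv hA hdesc]; exact_mod_cast hw

end Potential

/-! ### The dyadic network of fast paths -/

/-- The `ℓ¹`-distance on the half-plane. -/
def l1 (u v : ℤ × ℕ) : ℕ := (u.1 - v.1).natAbs + ((u.2 : ℤ) - v.2).natAbs

lemma adj_iff_l1 {u v : ℤ × ℕ} : halfPlane.Adj u v ↔ l1 u v = 1 := by
  change |u.1 - v.1| + |(u.2 : ℤ) - (v.2 : ℤ)| = 1 ↔ _
  rw [Int.abs_eq_natAbs, Int.abs_eq_natAbs, l1]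
  omega

lemma exists_adj_l1_lt {u v : ℤ × ℕ} (h : u ≠ v) :
    ∃ w, halfPlane.Adj w v ∧ l1 u w < l1 u v := by
  obtain ⟨a, b⟩ := u
  obtain ⟨x, y⟩ := v
  simp only [adj_iff_l1, l1, ne_eq, Prod.mk.injEq, not_and_or] at h ⊢
  rcases lt_trichotomy a x with hx | hx | hx
  · exact ⟨(x - 1, y), by dsimp only; omega, by dsimp only; omega⟩
  · rcases lt_or_ge b y with hy | hy
    · exact ⟨(x, y - 1), by dsimp only; omega, by dsimp only; omega⟩
    · exact ⟨(x, y + 1), by dsimp only; omega, by dsimp only; omega⟩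
  · exact ⟨(x + 1, y), by dsimp only; omega, by dsimp only; omega⟩

/-- The distance from `x` to the nearest of the three points `-t, 0, t`. -/
def fold (t : ℕ) (x : ℤ) : ℕ := min x.natAbs ((t : ℤ) - x.natAbs).natAbs

lemma fold_le_add (t : ℕ) (x x' : ℤ) : fold t x ≤ fold t x' + (x' - x).natAbs := by
  simp only [fold]; omega

lemma exists_fold_pred {t : ℕ} {x : ℤ} (h : 0 < fold t x) :
    ∃ x' : ℤ, (x' - x).natAbs = 1 ∧ fold t x' = fold t x - 1 := by
  by_cases h1 : fold t (x + 1) = fold t x - 1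
  · exact ⟨x + 1, by omega, h1⟩
  · refine ⟨x - 1, by omega, ?_⟩
    simp only [fold] at *
    omega

/-- The quadrant version of the network: a point at distance `z` from the line `d + y = t` belongs
to it if a power of two that is at least `z` divides one of its coordinates. -/
def InNetwork (t d y : ℕ) : Prop :=
  ∃ i : ℕ, d + y ≤ t ∧ t ≤ d + y + 2 ^ i ∧ (2 ^ i ∣ d ∨ 2 ^ i ∣ y)

/-- Every point of the network other than the origin has a neighbour in the network that is closer
to the origin. -/
lemma InNetwork.exists_pred {k d y : ℕ} (h : InNetwork (2 ^ k) d y) (hpos : 0 < d + y) :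
    (0 < d ∧ InNetwork (2 ^ k) (d - 1) y) ∨ (0 < y ∧ InNetwork (2 ^ k) d (y - 1)) := by
  obtain ⟨i, h1, h2, h3⟩ := h
  rcases Nat.eq_zero_or_pos d with rfl | hd
  -- Both coordinate axes belong to the network at scale `k`, since every power divides 0.
  · exact Or.inr ⟨by omega, k, by omega, by omega, by simp⟩
  rcases Nat.eq_zero_or_pos y with rfl | hy
  · exact Or.inl ⟨hd, k, by omega, by omega, by simp⟩
  rcases h2.lt_or_eq with hlt | heq
  · rcases h3 with h3 | h3
    · exact Or.inr ⟨hy, i, by omega, by omega, Or.inl h3⟩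
    · exact Or.inl ⟨hd, i, by omega, by omega, Or.inr h3⟩
  -- Bifurcation point of scale `i`: both coordinates are multiples of `2 ^ i` and their quotients
  -- have odd sum `2 ^ (k - i) - 1`. The even one marks the line of scale `i + 1` to follow.
  · have hik : i < k := (Nat.pow_lt_pow_iff_right (le_refl 2)).1 (by omega)
    obtain ⟨j, rfl⟩ := Nat.exists_eq_add_of_lt hik
    have hsum : d + y = 2 ^ i * (2 * 2 ^ j - 1) := by
      rw [Nat.mul_sub]
      have : 2 ^ (i + j + 1) = 2 ^ i * (2 * 2 ^ j) := by ring
      omega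
    have hpow : 2 ^ (i + 1) = 2 * 2 ^ i := by ring
    have hi : 0 < 2 ^ i := by positivity
    have hj : 0 < 2 ^ j := by positivity
    have hboth : 2 ^ i ∣ d ∧ 2 ^ i ∣ y := by
      have hs : 2 ^ i ∣ d + y := ⟨_, hsum⟩
      rcases h3 with h3 | h3
      · exact ⟨h3, (Nat.dvd_add_right h3).1 hs⟩
      · exact ⟨(Nat.dvd_add_left h3).1 hs, h3⟩
    obtain ⟨⟨p, rfl⟩, ⟨q, rfl⟩⟩ := hboth
    rw [← Nat.mul_add] at hsum
    have hpq := Nat.eq_of_mul_eq_mul_left hi hsum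
    rcases Nat.even_or_odd' p with ⟨r, hr | hr⟩
    · refine Or.inr ⟨hy, i + 1, by omega, by omega, Or.inl ⟨r, ?_⟩⟩
      rw [hr]; ring
    · obtain ⟨r', hr'⟩ : ∃ r', q = 2 * r' := ⟨q / 2, by omega⟩
      refine Or.inl ⟨hd, i + 1, by omega, by omega, Or.inr ⟨r', ?_⟩⟩
      rw [hr']; ring

/-- Below a branch of the network at height `Y` there is a hole of size comparable with the power
of two dividing `Y`: the point at horizontal distance `s` from the tip of the branch and at depth
`q` below it is far from the network. -/
lemma InNetwork.lt_of_hole {t l Y d y s q a b : ℕ} (hu : InNetwork t a b)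
    (hY : 2 ^ l ∣ Y) (ht : 2 ^ l ∣ t) (hd : d + Y + s = t) (hy : y + q = Y)
    (h1 : s < 2 * q) (h2 : q < 2 * s) (h3 : s + 2 * q < 2 ^ l) (h4 : 2 * s + q < 2 ^ l) :
    t < a + b + 2 * (((a : ℤ) - d).natAbs + ((b : ℤ) - y).natAbs) := by
  have step : ∀ {i A B : ℕ}, 2 ^ i ∣ A → 2 ^ i ∣ B → A < B → A + 2 ^ i ≤ B := by
    intro i A B hA hB hlt
    have := Nat.le_of_dvd (by omega) (Nat.dvd_sub hB hA)
    omega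
  have hX : 2 ^ l ∣ d + s := by
    have : d + s = t - Y := by omega
    rw [this]; exact Nat.dvd_sub ht hY
  obtain ⟨i, u1, u2, u3 | u3⟩ := hu
  -- The tip has abscissa `d + s`. Beyond it, `h2` makes the detour too long. Before it, a branch of
  -- scale `i ≤ l` lies at height at least `Y` (use `h1`), and a coarser one is at least `2 ^ l`
  -- away from the tip (use `h4`; `h3` in the mirrored case).
  · rcases le_or_gt (d + s) a with ha | ha
    · omega
    · rcases le_total i l with hil | hil
      · have := step u3 ((pow_dvd_pow 2 hil).trans hX) ha
        omega
      · have := step ((pow_dvd_pow 2 hil).trans u3) hX ha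
        omega
  · rcases le_or_gt Y b with hb | hb
    · omega
    · rcases le_total i l with hil | hil
      · have := step u3 ((pow_dvd_pow 2 hil).trans hY) hb
        omega
      · have := step ((pow_dvd_pow 2 hil).trans u3) hY hb
        omega

/-! ### The arrival times -/

/-- The possible arrival times at `v`: straight up from the axis at slow speed, or along the
network at fast speed up to a point `u` and from there at slow speed. -/
def arrivals (t : ℕ) (v : ℤ × ℕ) : Set ℕ :=
  {n | n = 2 * v.2 ∨ ∃ u : ℤ × ℕ, InNetwork t (fold t u.1) u.2 ∧
    n = fold t u.1 + u.2 + 2 * l1 u v}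

/-- The arrival time at `v`. -/
noncomputable def arrival (t : ℕ) (v : ℤ × ℕ) : ℕ := sInf (arrivals t v)

lemma arrival_mem (t : ℕ) (v : ℤ × ℕ) : arrival t v ∈ arrivals t v :=
  Nat.sInf_mem ⟨_, Or.inl rfl⟩

lemma arrival_le_axis (t : ℕ) (v : ℤ × ℕ) : arrival t v ≤ 2 * v.2 := Nat.sInf_le (Or.inl rfl)

lemma arrival_le_network {t : ℕ} {u : ℤ × ℕ} (hu : InNetwork t (fold t u.1) u.2) (v : ℤ × ℕ) :
    arrival t v ≤ fold t u.1 + u.2 + 2 * l1 u v := Nat.sInf_le (Or.inr ⟨u, hu, rfl⟩)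

lemma lt_arrival {t n : ℕ} {v : ℤ × ℕ} (haxis : n < 2 * v.2)
    (hnet : ∀ u : ℤ × ℕ, InNetwork t (fold t u.1) u.2 → n < fold t u.1 + u.2 + 2 * l1 u v) :
    n < arrival t v := by
  rcases arrival_mem t v with h | ⟨u, hu, h⟩
  · omega
  · have := hnet u hu
    omega

lemma arrival_eq_zero (t : ℕ) : ∀ a ∈ xAxis, arrival t a = 0 := by
  intro a ha
  have h := arrival_le_axis t a
  have : a.2 = 0 := ha
  omega

lemma arrival_le_add_two (t : ℕ) (u v : ℤ × ℕ) (h : halfPlane.Adj u v) :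
    arrival t v ≤ arrival t u + 2 := by
  rw [adj_iff_l1] at h
  rcases arrival_mem t u with h' | ⟨w, hw, h'⟩
  · have := arrival_le_axis t v
    simp only [l1] at h
    omega
  · have := arrival_le_network hw v
    simp only [l1] at *
    omega

lemma exists_arrival_lt {t k : ℕ} (ht : t = 2 ^ k) :
    ∀ v ∉ xAxis, ∃ u, halfPlane.Adj u v ∧ arrival t u < arrival t v := by
  rintro ⟨x, y⟩ hv
  replace hv : y ≠ 0 := hv
  rcases arrival_mem t (x, y) with h | ⟨u, hu, h⟩
  · refine ⟨(x, y - 1), by simp only [adj_iff_l1, l1]; omega, ?_⟩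
    have := arrival_le_axis t (x, y - 1)
    simp only at *
    omega
  · by_cases huv : u = (x, y)
    · subst huv
      have hl : l1 (x, y) (x, y) = 0 := by simp [l1]
      rw [ht] at hu
      simp only [hl] at *
      rcases hu.exists_pred (by omega) with ⟨hd, hp⟩ | ⟨hy, hp⟩
      · rw [← ht] at hd hp
        obtain ⟨x', hx', hf⟩ := exists_fold_pred hd
        refine ⟨(x', y), by simp only [adj_iff_l1, l1]; omega, ?_⟩
        have := arrival_le_network (u := (x', y)) (hf ▸ hp) (x', y)
        simp only [l1] at this
        omega
      · rw [← ht] at hp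
        refine ⟨(x, y - 1), by simp only [adj_iff_l1, l1]; omega, ?_⟩
        have := arrival_le_network (u := (x, y - 1)) hp (x, y - 1)
        simp only [l1] at this
        omega
    · obtain ⟨w, hw, hlt⟩ := exists_adj_l1_lt huv
      refine ⟨w, hw, ?_⟩
      have := arrival_le_network hu w
      omega

lemma le_arrival (t : ℕ) (v : ℤ × ℕ) : v.2 ≤ arrival t v := by
  rcases arrival_mem t v with h | ⟨u, -, h⟩
  · omega
  · simp only [l1] at h
    omega

/-! ### Active vertices -/

/-- The environment whose first passage time is `arrival t`. -/
noncomputable def dyadicEnv (t : ℕ) : Sym2 (ℤ × ℕ) → ℕ := potentialEnv (arrival t)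

/-- Needed because `ncard` is 0 on infinite sets. -/
lemma finite_activeSet_dyadicEnv {t k : ℕ} (ht : t = 2 ^ k) :
    (activeSet (dyadicEnv t) t).Finite := by
  refine ((Set.finite_Icc (-(t : ℤ)) t).prod (Set.finite_Iic t)).subset ?_
  rintro v ⟨h1, h2, w, -, hv, -⟩
  rw [dyadicEnv, passageTime_potentialEnv (arrival_eq_zero t) (exists_arrival_lt ht)] at hv
  exact ⟨⟨h1, h2⟩, (le_arrival t v).trans (by exact_mod_cast hv)⟩

lemma mem_activeSet_dyadicEnv {t k : ℕ} (ht : t = 2 ^ k) {v w : ℤ × ℕ} (hvt : v.1.natAbs ≤ t)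
    (hvw : l1 v w = 1) (hv : arrival t v ≤ t) (hw : t < arrival t w) :
    v ∈ activeSet (dyadicEnv t) t :=
  ⟨by omega, by omega, isActive_potentialEnv (arrival_eq_zero t) (exists_arrival_lt ht)
    (adj_iff_l1.2 hvw) hv hw⟩

/-- The vertices at which the network ends are active. -/
lemma tip_mem_activeSet {t k : ℕ} (ht : t = 2 ^ k) {x : ℤ} (hx : x.natAbs ≤ t) :
    (x, t - fold t x) ∈ activeSet (dyadicEnv t) t := by
  have hf : 2 * fold t x ≤ t := by simp only [fold]; omega
  refine mem_activeSet_dyadicEnv ht (w := (x, t - fold t x + 1)) hx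
    (by simp only [l1]; omega) ?_ ?_
  · have hnet : InNetwork t (fold t x) (t - fold t x) := ⟨0, by omega, by omega, by simp⟩
    have := arrival_le_network (u := (x, t - fold t x)) hnet (x, t - fold t x)
    simp only [l1] at this
    omega
  · refine lt_arrival (by simp only; omega) fun u _ => ?_
    have := fold_le_add t x u.1
    simp only [l1]
    omega

/-- The vertices above a hole are active. -/
lemma holeTop_mem_activeSet {t k l Y s : ℕ} {x : ℤ} (ht : t = 2 ^ k) (hx : x.natAbs ≤ t)
    (hlk : l ≤ k) (hY : 2 ^ l ∣ Y) (hd : fold t x + Y + s = t) (hs : 1 ≤ s)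
    (hsl : 5 * s + 2 < 2 * 2 ^ l) (haxis : t + 2 * 2 ^ l ≤ 2 * Y) :
    (x, Y - s / 2) ∈ activeSet (dyadicEnv t) t := by
  refine mem_activeSet_dyadicEnv ht (w := (x, Y - s / 2 - 1)) hx
    (by simp only [l1]; omega) ?_ ?_
  -- The branch is reached at time `t - s`, which leaves time for `s / 2` slow steps down; the next
  -- vertex, at depth `s / 2 + 1`, is still dry.
  · have hnet : InNetwork t (fold t x) Y := ⟨l, by omega, by omega, Or.inr hY⟩
    have := arrival_le_network (u := (x, Y)) hnet (x, Y - s / 2)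
    simp only [l1] at this
    omega
  · refine lt_arrival (by simp only; omega) fun u hu => ?_
    have h1 := hu.lt_of_hole hY (ht ▸ pow_dvd_pow 2 hlk) hd
      (y := Y - s / 2 - 1) (q := s / 2 + 1) (by omega) (by omega) (by omega) (by omega)
    have h2 := fold_le_add t x u.1
    have h3 := fold_le_add t u.1 x
    simp only [l1]
    omega

/-! ### Counting -/

/-- Parameters `⟨i, m, s⟩` of the vertices above holes: the hole has scale `2 ^ i`, the height of
the branch above it is `t - 2 ^ (i + 3) * (2 * m + 1)`, and `s` is the distance to its tip. -/
def holeIndex (n : ℕ) : Finset (Σ _ : ℕ, ℕ × ℕ) :=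
  (Finset.range n).sigma fun i => Finset.range (2 ^ (n - 1 - i)) ×ˢ Finset.Ico 1 (3 * 2 ^ i)

lemma card_holeIndex (n : ℕ) : 2 * (holeIndex n).card + 2 * 2 ^ n = 3 * n * 2 ^ n + 2 := by
  have hcard : ∀ n, (holeIndex n).card
      = ∑ i ∈ Finset.range n, 2 ^ (n - 1 - i) * (3 * 2 ^ i - 1) := by
    intro n; simp [holeIndex, Finset.card_sigma]
  induction n with
  | zero => simp [holeIndex]
  | succ n ih =>
    -- Raising `n` doubles the number of holes at each old scale and adds one hole of scale `n`.
    have hrec : (holeIndex (n + 1)).card = 2 * (holeIndex n).card + (3 * 2 ^ n - 1) := by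
      rw [hcard, hcard, Finset.sum_range_succ, Finset.mul_sum]
      congr 1
      · refine Finset.sum_congr rfl fun i hi => ?_
        have : n + 1 - 1 - i = (n - 1 - i) + 1 := by
          have := Finset.mem_range.1 hi
          omega
        rw [this]; ring
      · simp
    have hpos : 0 < 2 ^ n := by positivity
    have e1 : 3 * (n + 1) * 2 ^ (n + 1) = 2 * (3 * n * 2 ^ n) + 6 * 2 ^ n := by ring
    have e2 : 2 ^ (n + 1) = 2 * 2 ^ n := by ring
    omega

/-- The vertex above a hole, or one of its three mirror images. -/
def holeTop (t : ℕ) (p : (Σ _ : ℕ, ℕ × ℕ) × Bool × Bool) : ℤ × ℕ :=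
  let M := 2 ^ (p.1.1 + 3) * (2 * p.1.2.1 + 1)
  let d : ℤ := M - p.1.2.2
  let x : ℤ := if p.2.1 then d else t - d
  (if p.2.2 then x else -x, t - M - p.1.2.2 / 2)

lemma two_pow_mul_odd_inj {i i' m m' : ℕ}
    (h : 2 ^ i * (2 * m + 1) = 2 ^ i' * (2 * m' + 1)) : i = i' ∧ m = m' := by
  have key : ∀ {i i' m m' : ℕ}, 2 ^ i * (2 * m + 1) = 2 ^ i' * (2 * m' + 1) → i' ≤ i := by
    intro i i' m m' h
    by_contra! hlt
    obtain ⟨j, rfl⟩ := Nat.exists_eq_add_of_lt hlt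
    have h' : 2 ^ i * (2 * m + 1) = 2 ^ i * (2 * (2 ^ j * (2 * m' + 1))) := by rw [h]; ring
    have := Nat.eq_of_mul_eq_mul_left (by positivity) h'
    omega
  obtain rfl := le_antisymm (key h.symm) (key h)
  have := Nat.eq_of_mul_eq_mul_left (by positivity) h
  exact ⟨rfl, by omega⟩

/-- The distance `M` between the branch and the height `t` is at most `t / 2`, with a margin. -/
lemma holeIndex_bounds {n : ℕ} {i m s : ℕ} (h : (⟨i, m, s⟩ : Σ _ : ℕ, ℕ × ℕ) ∈ holeIndex n) :
    i < n ∧ 1 ≤ s ∧ s < 3 * 2 ^ i ∧ 8 * 2 ^ i ≤ 2 ^ (i + 3) * (2 * m + 1) ∧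
      2 * (2 ^ (i + 3) * (2 * m + 1)) + 16 * 2 ^ i ≤ 2 ^ (n + 4) := by
  simp only [holeIndex, Finset.mem_sigma, Finset.mem_range, Finset.mem_product,
    Finset.mem_Ico] at h
  obtain ⟨hi, hm, hs, hs'⟩ := h
  refine ⟨hi, hs, hs', ?_, ?_⟩
  · have : 2 ^ (i + 3) * (2 * m + 1) = 8 * 2 ^ i + 16 * (2 ^ i * m) := by ring
    omega
  · obtain ⟨j, rfl⟩ := Nat.exists_eq_add_of_lt hi
    have hj : i + j + 1 - 1 - i = j := by omega
    rw [hj] at hm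
    have := Nat.mul_le_mul_left (2 ^ i) (Nat.succ_le_of_lt hm)
    have e1 : 2 ^ i * m.succ = 2 ^ i * m + 2 ^ i := by rw [Nat.mul_succ]
    have e2 : 2 ^ (i + 3) * (2 * m + 1) = 8 * 2 ^ i + 16 * (2 ^ i * m) := by ring
    have e3 : 2 ^ (i + j + 1 + 4) = 32 * (2 ^ i * 2 ^ j) := by ring
    omega

/-- Since `M - s < t / 2`, all four mirror images have the same `fold`. -/
lemma fold_holeTop {n t : ℕ} (ht : t = 2 ^ (n + 4)) {i m s : ℕ} {b c : Bool}
    (h : (⟨i, m, s⟩ : Σ _ : ℕ, ℕ × ℕ) ∈ holeIndex n) :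
    (holeTop t (⟨i, m, s⟩, b, c)).1.natAbs ≤ t ∧
      fold t (holeTop t (⟨i, m, s⟩, b, c)).1 + s = 2 ^ (i + 3) * (2 * m + 1) := by
  obtain ⟨-, h1, h2, h3, h4⟩ := holeIndex_bounds h
  rw [← ht] at h4
  simp only [holeTop, fold]
  generalize 2 ^ (i + 3) * (2 * m + 1) = M at *
  cases b <;> cases c <;> simp only [if_true, if_false, Bool.false_eq_true] <;> omega

lemma holeTop_mem {n t : ℕ} (ht : t = 2 ^ (n + 4)) {p : (Σ _ : ℕ, ℕ × ℕ) × Bool × Bool}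
    (h : p.1 ∈ holeIndex n) : holeTop t p ∈ activeSet (dyadicEnv t) t := by
  obtain ⟨⟨i, m, s⟩, b, c⟩ := p
  obtain ⟨hi, h1, h2, h3, h4⟩ := holeIndex_bounds h
  obtain ⟨hx, hf⟩ := fold_holeTop (b := b) (c := c) ht h
  have hpow : 2 ^ (i + 3) = 8 * 2 ^ i := by ring
  have hdvd : 2 ^ (i + 3) ∣ t - 2 ^ (i + 3) * (2 * m + 1) :=
    Nat.dvd_sub (ht ▸ pow_dvd_pow 2 (by omega)) (Dvd.intro _ rfl)
  rw [← ht] at h4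
  have key := holeTop_mem_activeSet (s := s) ht hx (by omega) hdvd (by omega) h1
    (by omega) (by omega)
  exact key

lemma holeTop_injOn {n t : ℕ} (ht : t = 2 ^ (n + 4)) :
    Set.InjOn (holeTop t) ↑(holeIndex n ×ˢ (Finset.univ : Finset (Bool × Bool))) := by
  rintro ⟨⟨i, m, s⟩, b, c⟩ h ⟨⟨i', m', s'⟩, b', c'⟩ h' heq
  replace h := (Finset.mem_product.1 h).1
  replace h' := (Finset.mem_product.1 h').1
  have hf := (fold_holeTop (b := b) (c := c) ht h).2
  have hf' := (fold_holeTop (b := b') (c := c') ht h').2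
  obtain ⟨-, h1, h2, h3, h4⟩ := holeIndex_bounds h
  obtain ⟨-, h1', h2', h3', h4'⟩ := holeIndex_bounds h'
  rw [heq] at hf
  have hy : (holeTop t (⟨i, m, s⟩, b, c)).2 = (holeTop t (⟨i', m', s'⟩, b', c')).2 := by rw [heq]
  rw [← ht] at h4 h4'
  simp only [holeTop] at hy
  -- `fold` and the height determine `s + s / 2`, which is strictly increasing in `s`.
  obtain rfl : s = s' := by omega
  obtain ⟨hi, rfl⟩ := two_pow_mul_odd_inj (hf.symm.trans hf')
  obtain rfl : i = i' := by omega
  have hx : (holeTop t (⟨i, m, s⟩, b, c)).1 = (holeTop t (⟨i, m, s⟩, b', c')).1 := by rw [heq]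
  simp only [holeTop] at hx
  generalize 2 ^ (i + 3) * (2 * m + 1) = M at *
  cases b <;> cases c <;> cases b' <;> cases c' <;>
    simp only [if_true, if_false, Bool.false_eq_true] at hx <;> first | rfl | (exfalso; omega)

/-- The ends of the network above `[-t, t]`. -/
noncomputable def tips (t : ℕ) : Finset (ℤ × ℕ) :=
  (Finset.Icc (-(t : ℤ)) t).image fun x => (x, t - fold t x)

lemma card_tips (t : ℕ) : (tips t).card = 2 * t + 1 := by
  rw [tips, Finset.card_image_of_injective _ fun x y h => congrArg Prod.fst h, Int.card_Icc]
  omega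

lemma tips_subset {t k : ℕ} (ht : t = 2 ^ k) : ↑(tips t) ⊆ activeSet (dyadicEnv t) t := by
  intro v hv
  simp only [tips, Finset.coe_image, Set.mem_image, Finset.mem_coe, Finset.mem_Icc] at hv
  obtain ⟨x, hx, rfl⟩ := hv
  exact tip_mem_activeSet ht (by omega)

lemma card_tips_le_numActive {t k : ℕ} (ht : t = 2 ^ k) :
    2 * t + 1 ≤ numActive (dyadicEnv t) t := by
  rw [← card_tips t, ← Set.ncard_coe_finset, numActive]
  exact Set.ncard_le_ncard (tips_subset ht) (finite_activeSet_dyadicEnv ht)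

lemma card_le_numActive {n t : ℕ} (ht : t = 2 ^ (n + 4)) :
    2 * t + 1 + 4 * (holeIndex n).card ≤ numActive (dyadicEnv t) t := by
  set B := (holeIndex n ×ˢ (Finset.univ : Finset (Bool × Bool))).image (holeTop t) with hB
  have hBcard : B.card = 4 * (holeIndex n).card := by
    rw [hB, Finset.card_image_of_injOn (holeTop_injOn ht), Finset.card_product, mul_comm]
    rfl
  have hdisj : Disjoint (tips t) B := by
    rw [Finset.disjoint_left]
    intro v hv hv'
    simp only [tips, Finset.mem_image, Finset.mem_Icc] at hv
    obtain ⟨x, hx, rfl⟩ := hv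
    obtain ⟨⟨⟨i, m, s⟩, b, c⟩, hp, heq⟩ := Finset.mem_image.1 hv'
    replace hp := (Finset.mem_product.1 hp).1
    have hf := (fold_holeTop (b := b) (c := c) ht hp).2
    obtain ⟨-, h1, h2, h3, h4⟩ := holeIndex_bounds hp
    rw [heq] at hf
    have hy : (holeTop t (⟨i, m, s⟩, b, c)).2 = t - fold t x := by rw [heq]
    rw [← ht] at h4
    simp only [holeTop] at hy hf
    -- In the same column the tip has height `t - M + s`, above `t - M - s / 2`.
    omega
  rw [← card_tips t, ← hBcard, ← Finset.card_union_of_disjoint hdisj, ← Set.ncard_coe_finset,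
    numActive]
  refine Set.ncard_le_ncard ?_ (finite_activeSet_dyadicEnv ht)
  rw [Finset.coe_union]
  refine Set.union_subset (tips_subset ht) ?_
  intro v hv
  obtain ⟨p, hp, rfl⟩ := Finset.mem_image.1 (Finset.mem_coe.1 hv)
  exact holeTop_mem ht (Finset.mem_product.1 hp).1

lemma mul_le_numActive {t k : ℕ} (ht : t = 2 ^ k) :
    4 * (k * t) ≤ 15 * numActive (dyadicEnv t) t := by
  -- For `k < 4` the tips alone suffice, as `4 * 3 ≤ 15 * 2`.
  rcases lt_or_ge k 4 with hk | hk
  · have h1 := card_tips_le_numActive ht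
    have h2 : k * t ≤ 3 * t := Nat.mul_le_mul_right t (by omega)
    omega
  · obtain ⟨n, rfl⟩ := Nat.exists_eq_add_of_le' hk
    have h1 := card_le_numActive ht
    have h2 := card_holeIndex n
    have h3 : t = 16 * 2 ^ n := by rw [ht]; ring
    have h4 : (n + 4) * t = 16 * (n * 2 ^ n) + 64 * 2 ^ n := by rw [h3]; ring
    have h5 : 3 * n * 2 ^ n = 3 * (n * 2 ^ n) := by ring
    omega

end FPP

theorem mainTheorem1 :
    (0 : ℝ) < 4 / (15 * Real.log 2) ∧
    ∀ k t : ℕ, t = 2 ^ k →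
      ∃ ω : Sym2 (ℤ × ℕ) → ℕ, FPP.IsEnvironment ω ∧ (FPP.activeSet ω t).Finite ∧
        4 / (15 * Real.log 2) * (t : ℝ) * Real.log (t : ℝ) ≤ (FPP.numActive ω t : ℝ) := by
  have hlog : 0 < Real.log 2 := Real.log_pos one_lt_two
  refine ⟨by positivity, fun k t ht => ⟨FPP.dyadicEnv t,
    FPP.isEnvironment_potentialEnv (FPP.arrival_le_add_two t),
    FPP.finite_activeSet_dyadicEnv ht, ?_⟩⟩
  have h : 4 * ((k : ℝ) * t) ≤ 15 * FPP.numActive (FPP.dyadicEnv t) t := by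
    exact_mod_cast FPP.mul_le_numActive ht
  have hlt : Real.log (t : ℝ) = k * Real.log 2 := by
    rw [ht]; push_cast; rw [Real.log_pow]
  have heq : 4 / (15 * Real.log 2) * (t : ℝ) * Real.log (t : ℝ) = 4 * ((k : ℝ) * t) / 15 := by
    rw [hlt]; field_simp
  rw [heq]
  linarith
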